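/- Let $0<a<d<R$ be real numbers. Put $x^l=d\,l$ for $l\in\mathbb Z^3$, let $\Lambda=\{l\in\mathbb Z^3:\ |x^l|+\tfrac d2-a<R\}$, and let $\Omega_F$ be the open set $$\Omega_F=B(0,R)\setminus\bigcup_{l\in\Lambda}\overline{B(x^l,a)}\subset\mathbb R^3 .$$ Let $\|\cdot\|_{\partial\Omega_F}$ be the norm of $L^2(\partial\Omega_F)$ (real-valued functions, surface measure). Let $H^{1/2}(\Omega_F)$ be the space of real $u\in L^2(\Omega_F)$ for which the Hilbert-space interpolation norm of $[L^2(\Omega_F),H^1(\Omega_F)]_{1/2}$ is finite, that is $$\|u\|_{H^{1/2}(\Omega_F)}^2=\frac2\pi\int_0^\infty \inf_{v\in H^1(\Omega_F)}\Bigl(\|u-v\|_{L^2(\Omega_F)}^2+t^2\bigl(\|v\|_{L^2(\Omega_F)}^2+\|\nabla v\|_{L^2(\Omega_F)}^2\bigr)\Bigr)\frac{dt}{t^2}<\infty .$$ Then every $p\in L^2(\partial\Omega_F)$ has an extension $\tilde p\in H^{1/2}(\Omega_F)$ with $\tilde p|_{\partial\Omega_F}=p$ and $$\|\tilde p\|_{H^{1/2}(\Omega_F)}\le\beta\,\|p\|_{\partial\Omega_F},$$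 where $$\beta=2^{1/8}\sqrt{1+\tfrac6d}\,\Bigl(\tfrac d2+\tfrac1a+\sqrt2\Bigr)^{1/4}+2^{-1/4}\sqrt{1+\tfrac{3}{R-d/2}}\,\Bigl(1+\tfrac R3\Bigr)^{1/4}.$$ Here $\tilde p|_{\partial\Omega_F}=p$ means that for almost every $y\in\partial\Omega_F$ (surface measure) $$\lim_{r\to0^+}\frac1{|B(y,r)\cap\Omega_F|}\int_{B(y,r)\cap\Omega_F}|\tilde p(x)-p(y)|\,dx=0 .$$ -/

import Mathlib

open MeasureTheory Set Filter Topology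
open scoped ENNReal

/-- Euclidean three-space. -/
abbrev E3 : Type := EuclideanSpace ℝ (Fin 3)

/-! ### Geometry -/

/-- The lattice point `x^l = d l` of `d ℤ³`. -/
noncomputable def inclusionCenter (d : ℝ) (l : Fin 3 → ℤ) : E3 :=
  WithLp.toLp 2 (fun i => d * (l i : ℝ))

/-- The index set `Λ = {l ∈ ℤ³ : |x^l| + d/2 - a < R}`. -/
def inclusionIndex (a d R : ℝ) : Set (Fin 3 → ℤ) :=
  {l | ‖inclusionCenter d l‖ + d / 2 - a < R}

/-- The (open) fluid domain `Ω_F`: the ball `B(0,R)` without the inclusions `B(x^l,a)`, `l ∈ Λ`. -/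
def fluidDomain (a d R : ℝ) : Set E3 :=
  Metric.ball 0 R \ ⋃ l ∈ inclusionIndex a d R, Metric.closedBall (inclusionCenter d l) a

/-- The surface area measure of the sphere `∂B(c,r)`, as a measure on `ℝ³`: the image of the
surface measure of the unit sphere (total mass `4π`) under `z ↦ c + r z`, multiplied by `r²`. -/
noncomputable def sphereArea (c : E3) (r : ℝ) : Measure E3 :=
  ENNReal.ofReal (r ^ 2) •
    Measure.map (fun z : Metric.sphere (0 : E3) 1 => c + r • (z : E3))
      (volume : Measure E3).toSphere

/-- The surface area measure of `∂Ω_F`. The boundary lies in the union of the finitely many,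
pairwise distinct, spheres `∂B(0,R)` and `∂B(x^l,a)`, `l ∈ Λ`; two of them meet at most in a circle,
which has no area, so no part of the boundary is counted twice. -/
noncomputable def fluidBoundaryArea (a d R : ℝ) : Measure E3 :=
  (sphereArea 0 R +
    Measure.sum (fun l : inclusionIndex a d R => sphereArea (inclusionCenter d l) a)).restrict
      (frontier (fluidDomain a d R))

/-! ### The space `H^{1/2}(Ω)` -/

/-- `G` is the weak (distributional) gradient of `v` in the open set `Ω`. It is used only for
`v` and `G` square integrable on `Ω`, where both integrals converge. -/
def HasWeakGradient (Ω : Set E3) (v : E3 → ℝ) (G : E3 → E3) : Prop :=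
  ∀ φ : E3 → ℝ, ContDiff ℝ (⊤ : ℕ∞) φ → HasCompactSupport φ → tsupport φ ⊆ Ω →
    ∀ i : Fin 3, ∫ x in Ω, v x * fderiv ℝ φ x (EuclideanSpace.single i 1) =
      - ∫ x in Ω, G x i * φ x

/-- The square of the (quadratic) K-functional of the pair `L²(Ω)`, `H¹(Ω)`:
`K(t,u)² = inf {‖u - v‖²_{L²} + t² (‖v‖²_{L²} + ‖∇v‖²_{L²}) : v ∈ H¹(Ω)}`. -/
noncomputable def sobolevKSq (Ω : Set E3) (t : ℝ) (u : E3 → ℝ) : ℝ≥0∞ :=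
  ⨅ (v : E3 → ℝ) (G : E3 → E3) (_ : MemLp v 2 (volume.restrict Ω))
    (_ : MemLp G 2 (volume.restrict Ω)) (_ : HasWeakGradient Ω v G),
    eLpNorm (fun x => u x - v x) 2 (volume.restrict Ω) ^ 2 +
      ENNReal.ofReal (t ^ 2) *
        (eLpNorm v 2 (volume.restrict Ω) ^ 2 + eLpNorm G 2 (volume.restrict Ω) ^ 2)

/-- The norm of `H^{1/2}(Ω) = [L²(Ω), H¹(Ω)]_{1/2}`:
`‖u‖² = (2/π) ∫₀^∞ (t^{-1/2} K(t,u))² dt/t`. The factor `2/π` is the usual one, for which the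
interpolation norm of a pair of weighted `L²` spaces is the `L²` norm with the geometric mean
of the weights. -/
noncomputable def hHalfNorm (Ω : Set E3) (u : E3 → ℝ) : ℝ≥0∞ :=
  (ENNReal.ofReal (2 / Real.pi) *
    ∫⁻ t in Ioi (0 : ℝ), ENNReal.ofReal ((t ^ 2)⁻¹) * sobolevKSq Ω t u) ^ (1 / 2 : ℝ)

/-- `u ∈ H^{1/2}(Ω)`. -/
def MemHHalf (Ω : Set E3) (u : E3 → ℝ) : Prop :=
  MemLp u 2 (volume.restrict Ω) ∧ hHalfNorm Ω u < ∞

/-- `u|_{∂Ω} = p`, where `σ` is the surface measure of `∂Ω`: for `σ`-almost every `y`, the mean of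
`|u - p(y)|` over `B(y,r) ∩ Ω` tends to `0` as `r → 0+`. -/
def HasBoundaryTrace (Ω : Set E3) (σ : Measure E3) (u p : E3 → ℝ) : Prop :=
  ∀ᵐ y ∂σ, Tendsto (fun r : ℝ => ⨍⁻ x in Metric.ball y r ∩ Ω, ‖u x - p y‖ₑ ∂volume) (𝓝[>] 0) (𝓝 0)

/-! ### The constant -/

/-- The constant `β`. -/
noncomputable def extensionConst (a d R : ℝ) : ℝ :=
  (2 : ℝ) ^ (1 / 8 : ℝ) * √(1 + 6 / d) * (d / 2 + a⁻¹ + √2) ^ (1 / 4 : ℝ) +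
    (2 : ℝ) ^ (-(1 / 4) : ℝ) * √(1 + 3 * (R - d / 2)⁻¹) * (1 + R / 3) ^ (1 / 4 : ℝ)

/-! `H^{1/2}` is the critical space for traces: boundary values in `L²` are attained by functions of
arbitrarily small `H^{1/2}` norm. Hence `β` matters only through its positivity, and the geometry
only through three facts: the domain is open, its boundary is compact, and the boundary layer of
width `s` has volume `O(s)`.

A function of size `m` that lives in a layer of width `s` and has slope of order `m / s` has `L²`
norm of order `m √s` and gradient norm of order `m / √s`. Its squared `H^{1/2}` norm is therefore of
order `m²`, whatever `s` is. For very different widths such functions are almost orthogonal, so a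
sum of them has squared norm of order `∑ m n ^ 2` (`lintegral_sobolevKSq_le`). With `m n = η / (n +
1)` this is `O(η²)`, while `∑ m n` diverges. The divergence lets Lipschitz functions `A n` with `|A
(n + 1) - A n| ≤ m n` still converge to `p` almost everywhere (`tendsto_slowApprox`).

The extension is the sum of the increments of `A`, the `n`-th cut off at distance `s n` from the
boundary. At distance about `s n` the earlier increments add up to `A n`, two further ones are
small, and the others are supported in layers of negligible volume if the widths shrink fast enough
(`exists_scales`). This gives the trace (`hasBoundaryTrace_layeredSeries`). -/

/-! ### Slow approximation of a convergent sequence -/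

/-- The sequence which starts at `0` and moves in its `n`-th step towards `y n`, by at most `m n`. -/
noncomputable def slowApprox (m y : ℕ → ℝ) : ℕ → ℝ
  | 0 => 0
  | n + 1 => slowApprox m y n + max (-m n) (min (m n) (y n - slowApprox m y n))

lemma abs_slowApprox_succ_sub_le {m : ℕ → ℝ} (hm : ∀ n, 0 ≤ m n) (y : ℕ → ℝ) (n : ℕ) :
    |slowApprox m y (n + 1) - slowApprox m y n| ≤ m n := by
  have := hm n
  rw [slowApprox, add_sub_cancel_left, abs_le]
  exact ⟨le_max_left _ _, max_le (by linarith) (min_le_left _ _)⟩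

/-- A truncated step either comes closer to `l` by the full `m n` or passes `l` and stops between
`l` and `y n`. An untruncated step lands on `y n`. -/
lemma abs_slowApprox_succ_sub_le_max {m y : ℕ → ℝ} (hm : ∀ n, 0 ≤ m n) {l δ : ℝ} {n : ℕ}
    (hy : |y n - l| ≤ δ) :
    |slowApprox m y (n + 1) - l| ≤ max (|slowApprox m y n - l| - m n) δ := by
  have := hm n
  rw [slowApprox]
  generalize slowApprox m y n = x
  rw [abs_le] at hy
  rw [le_max_iff]
  rcases max_cases (-m n) (min (m n) (y n - x)) with h | h <;>
  rcases min_cases (m n) (y n - x) with h' | h' <;>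
  rcases abs_cases (x - l) with h₁ | h₁ <;>
  rcases abs_cases (x + max (-m n) (min (m n) (y n - x)) - l) with h₂ | h₂ <;>
  first
    | (left; linarith)
    | (right; linarith)

lemma tendsto_slowApprox {m y : ℕ → ℝ} (hm : ∀ n, 0 ≤ m n)
    (hdiv : Tendsto (fun n => ∑ i ∈ Finset.range n, m i) atTop atTop) {l : ℝ}
    (hy : Tendsto y atTop (𝓝 l)) : Tendsto (slowApprox m y) atTop (𝓝 l) := by
  rw [Metric.tendsto_atTop]
  intro ε hε
  obtain ⟨N, hN⟩ := Metric.tendsto_atTop.1 hy (ε / 2) (by positivity)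
  -- From time `N` on, the initial error is used up at the rate `m i` until it is below `ε / 2`,
  -- where it stays. Divergence of `∑ m` ensures that this happens.
  have key : ∀ k, |slowApprox m y (N + k) - l| ≤
      max (|slowApprox m y N - l| - (∑ i ∈ Finset.range (N + k), m i -
        ∑ i ∈ Finset.range N, m i)) (ε / 2) := by
    intro k
    induction k with
    | zero => simp
    | succ k ih =>
      have h1 := abs_slowApprox_succ_sub_le_max hm (hN (N + k) (by omega)).le
      refine h1.trans (max_le ?_ (le_max_right _ _))
      rw [← add_assoc, Finset.sum_range_succ]
      have := hm (N + k)
      rcases le_max_iff.1 ih with h | h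
      · exact le_max_of_le_left (by linarith)
      · exact le_max_of_le_right (by linarith)
  obtain ⟨M, hM⟩ := tendsto_atTop_atTop.1 hdiv
    (|slowApprox m y N - l| + ∑ i ∈ Finset.range N, m i)
  refine ⟨max N M, fun n hn => ?_⟩
  obtain ⟨k, rfl⟩ := Nat.exists_eq_add_of_le ((le_max_left _ _).trans hn)
  rw [Real.dist_eq]
  refine (key k).trans_lt (max_lt ?_ (by linarith))
  have := hM (N + k) ((le_max_right _ _).trans hn)
  linarith

lemma exists_lipschitzWith_slowApprox {X : Type*} [PseudoEMetricSpace X] (m : ℕ → ℝ)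
    {P : ℕ → X → ℝ} (hP : ∀ n, ∃ L, LipschitzWith L (P n)) (n : ℕ) :
    ∃ L, LipschitzWith L (fun x => slowApprox m (fun k => P k x) n) := by
  induction n with
  | zero => exact ⟨0, LipschitzWith.const 0⟩
  | succ n ih =>
    obtain ⟨L, hL⟩ := ih
    obtain ⟨L', hL'⟩ := hP n
    exact ⟨_, hL.add (((hL'.sub hL).const_min (m n)).const_max (-m n))⟩

/-! ### Weak gradients of Lipschitz functions -/

/-- The vector of partial derivatives. -/
noncomputable def partialDerivs (u : E3 → ℝ) (x : E3) : E3 :=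
  WithLp.toLp 2 fun i => lineDeriv ℝ u x (EuclideanSpace.single i 1)

lemma measurable_partialDerivs {u : E3 → ℝ} (hu : Continuous u) :
    Measurable (partialDerivs u) :=
  (WithLp.measurable_toLp 2 _).comp (measurable_pi_lambda _ fun _ => measurable_lineDeriv hu)

lemma norm_partialDerivs_le {u : E3 → ℝ} {L : NNReal} (hu : LipschitzWith L u) (x : E3) :
    ‖partialDerivs u x‖ ≤ 2 * L := by
  have h : ∀ i, ‖lineDeriv ℝ u x (EuclideanSpace.single i 1)‖ ≤ L := fun i => by
    simpa using norm_lineDeriv_le_of_lipschitz ℝ (x₀ := x)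
      (v := (EuclideanSpace.single i 1 : E3)) hu
  rw [EuclideanSpace.norm_eq, Real.sqrt_le_left (by positivity)]
  calc _ ≤ ∑ _i : Fin 3, (L : ℝ) ^ 2 := Finset.sum_le_sum fun i _ => by
        gcongr; exact h i
    _ ≤ _ := by simp; nlinarith [sq_nonneg (L : ℝ)]

lemma partialDerivs_eq_zero {u : E3 → ℝ} {x : E3} (hu : u =ᶠ[𝓝 x] 0) :
    partialDerivs u x = 0 := by
  ext i
  simp only [partialDerivs, PiLp.zero_apply]
  rw [hu.lineDeriv_eq]
  simp [lineDeriv]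

/-- Integration by parts for Lipschitz functions holds on the whole space. Since the test function
is supported in `Ω`, both integrals over `Ω` are integrals over the whole space. -/
lemma LipschitzWith.hasWeakGradient {u : E3 → ℝ} {L : NNReal} (hu : LipschitzWith L u)
    (Ω : Set E3) : HasWeakGradient Ω u (partialDerivs u) := by
  intro φ hφ hφc hφΩ i
  obtain ⟨D, hD⟩ := hφ.lipschitzWith_of_hasCompactSupport hφc (by simp)
  have key := hu.integral_lineDeriv_mul_eq (μ := volume) hD hφc (EuclideanSpace.single i 1)
  have h0 : ∀ x, x ∉ Ω → φ x = 0 := fun x hx => image_eq_zero_of_notMem_tsupport fun h => hx (hφΩ h)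
  have h1 : ∀ x, x ∉ Ω → fderiv ℝ φ x = 0 := fun x hx => by
    refine image_eq_zero_of_notMem_tsupport fun h => hx (hφΩ (tsupport_fderiv_subset ℝ h))
  rw [setIntegral_eq_integral_of_forall_compl_eq_zero fun x hx => by simp [h1 x hx],
    setIntegral_eq_integral_of_forall_compl_eq_zero fun x hx => by simp [h0 x hx]]
  simp only [partialDerivs]
  rw [key, ← integral_neg]
  congr 1 with x
  rw [(hφ.differentiable (by simp) x).lineDeriv_eq_fderiv, map_neg]
  ring

lemma HasWeakGradient.sum {Ω : Set E3} {u : ℕ → E3 → ℝ} {G : ℕ → E3 → E3}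
    (hu : ∀ n, MemLp (u n) 2 (volume.restrict Ω)) (hG : ∀ n, MemLp (G n) 2 (volume.restrict Ω))
    (h : ∀ n, HasWeakGradient Ω (u n) (G n)) (s : Finset ℕ) :
    HasWeakGradient Ω (fun x => ∑ n ∈ s, u n x) (fun x => ∑ n ∈ s, G n x) := by
  intro φ hφ hφc hφΩ i
  have hφ1 : MemLp φ 2 (volume.restrict Ω) := (hφ.continuous.memLp_of_hasCompactSupport hφc).restrict _
  have hφ2 : MemLp (fun x => fderiv ℝ φ x (EuclideanSpace.single i 1)) 2 (volume.restrict Ω) := by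
    refine (Continuous.memLp_of_hasCompactSupport ?_ ?_).restrict _
    · exact (hφ.continuous_fderiv (by simp)).clm_apply continuous_const
    · exact hφc.fderiv_apply ℝ _
  have hGi : ∀ n, MemLp (fun x => G n x i) 2 (volume.restrict Ω) := fun n =>
    (EuclideanSpace.proj (𝕜 := ℝ) i).comp_memLp' (hG n)
  simp only [Finset.sum_mul, WithLp.ofLp_sum, Finset.sum_apply]
  have h1 : ∀ n, Integrable (fun x => u n x * fderiv ℝ φ x (EuclideanSpace.single i 1))
      (volume.restrict Ω) := fun n => (hu n).integrable_mul hφ2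
  have h2 : ∀ n, Integrable (fun x => G n x i * φ x) (volume.restrict Ω) :=
    fun n => (hGi n).integrable_mul hφ1
  rw [integral_finsetSum _ fun n _ => h1 n, integral_finsetSum _ fun n _ => h2 n,
    ← Finset.sum_neg_distrib]
  exact Finset.sum_congr rfl fun n _ => h n φ hφ hφc hφΩ i

/-! ### The interpolation norm of a lacunary series -/

lemma sobolevKSq_le {Ω : Set E3} {u v : E3 → ℝ} {G : E3 → E3} (hv : MemLp v 2 (volume.restrict Ω))
    (hG : MemLp G 2 (volume.restrict Ω)) (h : HasWeakGradient Ω v G) (t : ℝ) :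
    sobolevKSq Ω t u ≤ eLpNorm (fun x => u x - v x) 2 (volume.restrict Ω) ^ 2 +
      ENNReal.ofReal (t ^ 2) *
        (eLpNorm v 2 (volume.restrict Ω) ^ 2 + eLpNorm G 2 (volume.restrict Ω) ^ 2) :=
  iInf_le_of_le v <| iInf_le_of_le G <| iInf_le_of_le hv <| iInf_le_of_le hG <| iInf_le _ h

lemma lintegral_Ioi_inv_sq {c : ℝ} (hc : 0 < c) :
    ∫⁻ t in Ioi c, ENNReal.ofReal ((t ^ 2)⁻¹) = ENNReal.ofReal c⁻¹ := by
  have h : ∀ t : ℝ, (t ^ 2)⁻¹ = t ^ (-2 : ℝ) := fun t => by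
    rw [Real.rpow_neg_ofNat]; norm_cast
  simp only [h]
  rw [← ofReal_integral_eq_lintegral_ofReal (integrableOn_Ioi_rpow_of_lt (by norm_num) hc),
    integral_Ioi_rpow_of_lt (by norm_num) hc]
  · congr 1
    norm_num
    exact Real.rpow_neg_one c
  · filter_upwards [ae_restrict_mem measurableSet_Ioi] with t ht
    have : 0 < t := hc.trans ht
    positivity

lemma sum_Ico_le_of_le_half {g : ℕ → ℝ} (hg : ∀ n, 0 ≤ g n) (h : ∀ n, 2 * g (n + 1) ≤ g n)
    (n N : ℕ) : ∑ j ∈ Finset.Ico n N, g j ≤ 2 * g n := by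
  rcases le_total N n with hN | hN
  · simp [Finset.Ico_eq_empty_of_le hN, hg n]
  -- The subtracted term makes the claim strong enough for induction.
  suffices ∑ j ∈ Finset.Ico n N, g j ≤ 2 * g n - 2 * g N by linarith [hg N]
  induction N, hN using Nat.le_induction with
  | base => simp
  | succ N hN ih =>
    rw [Finset.sum_Ico_succ_top hN]
    linarith [h N]

lemma sum_range_succ_le_of_double_le {h : ℕ → ℝ} (h0 : ∀ n, 0 ≤ h n)
    (hd : ∀ n, 2 * h n ≤ h (n + 1)) (n : ℕ) : ∑ j ∈ Finset.range (n + 1), h j ≤ 2 * h n := by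
  induction n with
  | zero => simp; linarith [h0 0]
  | succ n ih =>
    rw [Finset.sum_range_succ]
    linarith [hd n]

lemma eLpNorm_finset_sum_le {E : Type*} [NormedAddCommGroup E] {α : Type*} [MeasurableSpace α]
    {μ : Measure α} {f : ℕ → α → E} (hf : ∀ n, AEStronglyMeasurable (f n) μ) {b : ℕ → ℝ}
    (hb : ∀ n, 0 ≤ b n) (hfb : ∀ n, eLpNorm (f n) 2 μ ≤ ENNReal.ofReal (b n)) (s : Finset ℕ)
    {B : ℝ} (hB : ∑ n ∈ s, b n ≤ B) :
    eLpNorm (fun x => ∑ n ∈ s, f n x) 2 μ ≤ ENNReal.ofReal B := by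
  have : (fun x => ∑ n ∈ s, f n x) = ∑ n ∈ s, f n := by ext x; simp
  rw [this]
  calc _ ≤ ∑ n ∈ s, eLpNorm (f n) 2 μ := eLpNorm_sum_le (fun n _ => hf n) (by norm_num)
    _ ≤ ∑ n ∈ s, ENNReal.ofReal (b n) := Finset.sum_le_sum fun n _ => hfb n
    _ = ENNReal.ofReal (∑ n ∈ s, b n) := (ENNReal.ofReal_sum_of_nonneg fun n _ => hb n).symm
    _ ≤ _ := ENNReal.ofReal_le_ofReal hB

/-- Fatou's lemma carries the uniform bound for the finite tails over to their almost everywhere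
limit. -/
lemma eLpNorm_sub_partial_sum_le {α : Type*} [MeasurableSpace α]
    {μ : Measure α} {f : ℕ → α → ℝ} (hf : ∀ n, AEStronglyMeasurable (f n) μ) {b : ℕ → ℝ}
    (hb : ∀ n, 0 ≤ b n) (hfb : ∀ n, eLpNorm (f n) 2 μ ≤ ENNReal.ofReal (b n)) {q : α → ℝ}
    (hq : ∀ᵐ x ∂μ, Tendsto (fun n => ∑ j ∈ Finset.range n, f j x) atTop (𝓝 (q x))) (n : ℕ)
    {B : ℝ} (hB : ∀ N, ∑ j ∈ Finset.Ico n N, b j ≤ B) :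
    eLpNorm (fun x => q x - ∑ j ∈ Finset.range n, f j x) 2 μ ≤ ENNReal.ofReal B := by
  refine (Lp.eLpNorm_lim_le_liminf_eLpNorm
    (f := fun N x => ∑ j ∈ Finset.range N, f j x - ∑ j ∈ Finset.range n, f j x)
    (fun N => ?_) _ ?_).trans ?_
  · exact (Finset.aestronglyMeasurable_fun_sum _ fun j _ => hf j).sub
      (Finset.aestronglyMeasurable_fun_sum _ fun j _ => hf j)
  · filter_upwards [hq] with x hx using hx.sub_const _
  · refine liminf_le_of_frequently_le' (Eventually.frequently ?_)
    filter_upwards [eventually_ge_atTop n] with N hN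
    simp only [← Finset.sum_Ico_eq_sub _ hN]
    exact eLpNorm_finset_sum_le hf hb hfb _ (hB N)

lemma antitone_of_le_div {s : ℕ → ℝ} (hs : ∀ n, 0 < s n) (hs2 : ∀ n, s (n + 1) ≤ s n / 16) : Antitone s :=
  antitone_nat_of_succ_le fun n => by linarith [hs n, hs2 n]

lemma tendsto_zero_of_le_div {s : ℕ → ℝ} (hs : ∀ n, 0 < s n) (hs2 : ∀ n, s (n + 1) ≤ s n / 16) :
    Tendsto s atTop (𝓝 0) := by
  have hgeo : ∀ n, s n ≤ s 0 * (1 / 2) ^ n := fun n => by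
    induction n with
    | zero => simp
    | succ n ih => rw [pow_succ]; linarith [hs2 n, hs n]
  refine squeeze_zero (fun n => (hs n).le) hgeo ?_
  simpa using (tendsto_pow_atTop_nhds_zero_of_lt_one (r := (1 / 2 : ℝ)) (by norm_num)
    (by norm_num)).const_mul (s 0)

lemma exists_mem_Ioc_of_le_div {s : ℕ → ℝ} (hs : ∀ n, 0 < s n)
    (hs2 : ∀ n, s (n + 1) ≤ s n / 16) {t : ℝ} (ht : 0 < t) (N : ℕ) (htN : t ≤ s N) :
    ∃ n, N ≤ n ∧ t ∈ Ioc (s (n + 1)) (s n) := by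
  have hex : ∃ n, s n < t := ((tendsto_zero_of_le_div hs hs2).eventually_lt_const ht).exists
  classical
  have hfind : N < Nat.find hex := by
    by_contra h
    exact absurd (Nat.find_spec hex)
      (not_lt.2 (htN.trans (antitone_of_le_div hs hs2 (not_lt.1 h))))
  obtain ⟨n, hn⟩ := Nat.exists_eq_succ_of_ne_zero (n := Nat.find hex) (by omega)
  refine ⟨n, by omega, ?_, not_lt.1 (Nat.find_min hex (by omega))⟩
  have := Nat.find_spec hex
  rwa [hn] at this

/-- A discrete Hardy inequality for the `K`-functional: the interpolation norm of a series `∑ u n`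
whose terms live at very different scales `s n` is controlled by the `ℓ²` sum of the norms. -/
lemma lintegral_sobolevKSq_le {Ω : Set E3} {u : ℕ → E3 → ℝ} {G : ℕ → E3 → E3}
    {c : ℝ} (hc : 0 ≤ c) {m s : ℕ → ℝ} (hm : ∀ n, 0 ≤ m n) (hm1 : ∀ n, m (n + 1) ≤ m n)
    (hm2 : ∀ n, m n ≤ 2 * m (n + 1)) (hs : ∀ n, 0 < s n) (hs1 : ∀ n, s n ≤ 1)
    (hs2 : ∀ n, s (n + 1) ≤ s n / 16)
    (hu : ∀ n, MemLp (u n) 2 (volume.restrict Ω)) (hG : ∀ n, MemLp (G n) 2 (volume.restrict Ω))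
    (huG : ∀ n, HasWeakGradient Ω (u n) (G n))
    (hub : ∀ n, eLpNorm (u n) 2 (volume.restrict Ω) ≤ ENNReal.ofReal (c * (m n * √(s n))))
    (hGb : ∀ n, eLpNorm (G n) 2 (volume.restrict Ω) ≤ ENNReal.ofReal (c * (m n / √(s n))))
    {q : E3 → ℝ} (hq : ∀ᵐ x ∂(volume.restrict Ω),
      Tendsto (fun n => ∑ j ∈ Finset.range n, u j x) atTop (𝓝 (q x))) :
    ∫⁻ t in Ioi (0 : ℝ), ENNReal.ofReal ((t ^ 2)⁻¹) * sobolevKSq Ω t q ≤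
      ENNReal.ofReal (16 * c ^ 2) * ∑' n, ENNReal.ofReal (m n ^ 2) := by
  set μ := volume.restrict Ω
  have hr : ∀ n, 0 < √(s n) := fun n => Real.sqrt_pos.2 (hs n)
  have hr1 : ∀ n, √(s n) ≤ 1 := fun n => Real.sqrt_le_one.2 (hs1 n)
  have hr2 : ∀ n, √(s (n + 1)) ≤ √(s n) / 4 := fun n => by
    rw [Real.sqrt_le_left (by have := hr n; positivity), div_pow, Real.sq_sqrt (hs n).le]
    linarith [hs2 n]
  have hg : ∀ n, 2 * (c * (m (n + 1) * √(s (n + 1)))) ≤ c * (m n * √(s n)) := fun n => by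
    have : m (n + 1) * √(s (n + 1)) ≤ m n * (√(s n) / 4) :=
      mul_le_mul (hm1 n) (hr2 n) (hr _).le (hm n)
    nlinarith [mul_nonneg hc (mul_nonneg (hm n) (hr n).le), mul_le_mul_of_nonneg_left this hc]
  -- From one scale to the next `√s` falls at least fourfold and `m` at most twofold. So the `L²`
  -- bounds at least halve, the gradient bounds at least double, and geometric sums are governed by
  -- one extreme term.
  have hh : ∀ n, 2 * (c * (m n / √(s n))) ≤ c * (m (n + 1) / √(s (n + 1))) := fun n => by
    have : 2 * (m n / √(s n)) ≤ m (n + 1) / √(s (n + 1)) := by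
      rw [le_div_iff₀ (hr _), mul_div_assoc', div_mul_eq_mul_div, div_le_iff₀ (hr _)]
      have h1 : 2 * m n * √(s (n + 1)) ≤ 2 * (2 * m (n + 1)) * (√(s n) / 4) :=
        mul_le_mul (by linarith [hm2 n]) (hr2 n) (hr _).le (by linarith [hm (n + 1)])
      linarith
    nlinarith [mul_le_mul_of_nonneg_left this hc]
  have hg0 : ∀ n, 0 ≤ c * (m n * √(s n)) := fun n =>
    mul_nonneg hc (mul_nonneg (hm n) (hr n).le)
  have hh0 : ∀ n, 0 ≤ c * (m n / √(s n)) := fun n =>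
    mul_nonneg hc (div_nonneg (hm n) (hr n).le)
  -- Because `s n ≤ 1`, the gradient bound also serves for the function, hence for the whole `H¹`
  -- norm.
  have hub' : ∀ n, eLpNorm (u n) 2 μ ≤ ENNReal.ofReal (c * (m n / √(s n))) := fun n => by
    refine (hub n).trans (ENNReal.ofReal_le_ofReal (mul_le_mul_of_nonneg_left ?_ hc))
    rw [le_div_iff₀ (hr n), mul_assoc]
    exact mul_le_of_le_one_right (hm n) (mul_le_one₀ (hr1 n) (hr n).le (hr1 n))
  have tail : ∀ n, eLpNorm (fun x => q x - ∑ j ∈ Finset.range n, u j x) 2 μ ≤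
      ENNReal.ofReal (2 * (c * (m n * √(s n)))) := fun n =>
    eLpNorm_sub_partial_sum_le (fun n => (hu n).1) hg0 hub hq n
      (sum_Ico_le_of_le_half hg0 hg n)
  have sqA : ∀ n, (2 * (c * (m n * √(s n)))) ^ 2 = 4 * c ^ 2 * m n ^ 2 * s n := fun n => by
    rw [mul_pow, mul_pow, mul_pow, Real.sq_sqrt (hs n).le]; ring
  have sqB : ∀ n, (2 * (c * (m n / √(s n)))) ^ 2 = 4 * c ^ 2 * m n ^ 2 * (s n)⁻¹ := fun n => by
    rw [mul_pow, mul_pow, div_pow, Real.sq_sqrt (hs n).le]; ring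
  -- Above the largest scale the competitor `v = 0` suffices.
  have first : ∫⁻ t in Ioi (s 0), ENNReal.ofReal ((t ^ 2)⁻¹) * sobolevKSq Ω t q ≤
      ENNReal.ofReal (4 * c ^ 2 * m 0 ^ 2) := by
    calc _ ≤ ∫⁻ t in Ioi (s 0), ENNReal.ofReal ((t ^ 2)⁻¹) *
          ENNReal.ofReal (4 * c ^ 2 * m 0 ^ 2 * s 0) := by
          refine lintegral_mono fun t => mul_le_mul_right ?_ _
          refine (sobolevKSq_le (v := 0) (G := 0) MemLp.zero MemLp.zero ?_ t).trans ?_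
          · intro φ _ _ _ i; simp
          · have := tail 0
            simp only [Finset.range_zero, Finset.sum_empty] at this
            simp only [Pi.zero_apply, eLpNorm_zero]
            rw [← sqA, ENNReal.ofReal_pow (mul_nonneg zero_le_two (hg0 0))]
            have h2 := pow_le_pow_left' this 2
            simp only [sub_zero] at h2 ⊢
            simpa using h2
      _ = ENNReal.ofReal (4 * c ^ 2 * m 0 ^ 2) := by
          rw [lintegral_mul_const' _ _ ENNReal.ofReal_ne_top, lintegral_Ioi_inv_sq (hs 0),
            ← ENNReal.ofReal_mul (inv_nonneg.2 (hs 0).le)]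
          congr 1
          field_simp [(hs 0).ne']
  -- The competitor is the sum of the terms `0, …, n`. Its tail, of squared norm `O(s (n + 1))`, is
  -- integrated against `t⁻²` and gives `4 c² m (n + 1)²`. Its squared `H¹` norm, `O((s n)⁻¹)`, is
  -- integrated over a length of at most `s n` and gives `8 c² m n²`.
  have piece : ∀ n, ∫⁻ t in Ioc (s (n + 1)) (s n), ENNReal.ofReal ((t ^ 2)⁻¹) * sobolevKSq Ω t q ≤
      ENNReal.ofReal (12 * c ^ 2 * m n ^ 2) := fun n => by
    calc _ ≤ ∫⁻ t in Ioc (s (n + 1)) (s n), (ENNReal.ofReal ((t ^ 2)⁻¹) *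
            ENNReal.ofReal (4 * c ^ 2 * m (n + 1) ^ 2 * s (n + 1)) +
            ENNReal.ofReal (8 * c ^ 2 * m n ^ 2 * (s n)⁻¹)) := by
          refine setLIntegral_mono' measurableSet_Ioc fun t ht => ?_
          have ht0 : 0 < t := (hs _).trans ht.1
          have hK := sobolevKSq_le (u := q) (memLp_finsetSum (Finset.range (n + 1))
            fun j _ => hu j) (memLp_finsetSum (Finset.range (n + 1)) fun j _ => hG j)
            (HasWeakGradient.sum hu hG huG _) t
          have h1 := tail (n + 1)
          have h2 := eLpNorm_finset_sum_le (fun n => (hu n).1) hh0 hub' (Finset.range (n + 1))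
            (sum_range_succ_le_of_double_le hh0 hh n)
          have h3 := eLpNorm_finset_sum_le (fun n => (hG n).1) hh0 hGb (Finset.range (n + 1))
            (sum_range_succ_le_of_double_le hh0 hh n)
          have h1' := pow_le_pow_left' h1 2
          have h2' := pow_le_pow_left' h2 2
          have h3' := pow_le_pow_left' h3 2
          rw [← ENNReal.ofReal_pow (by linarith [hg0 (n + 1)]), sqA] at h1'
          rw [← ENNReal.ofReal_pow (by linarith [hh0 n]), sqB] at h2' h3'
          calc _ ≤ ENNReal.ofReal ((t ^ 2)⁻¹) *
                (ENNReal.ofReal (4 * c ^ 2 * m (n + 1) ^ 2 * s (n + 1)) + ENNReal.ofReal (t ^ 2) *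
                  (ENNReal.ofReal (4 * c ^ 2 * m n ^ 2 * (s n)⁻¹) +
                    ENNReal.ofReal (4 * c ^ 2 * m n ^ 2 * (s n)⁻¹))) := by
                  refine mul_le_mul_right (hK.trans ?_) _
                  exact add_le_add h1' (mul_le_mul_right (add_le_add h2' h3') _)
            _ = _ := by
                  have := inv_nonneg.2 (hs n).le
                  rw [← ENNReal.ofReal_add (by positivity) (by positivity), mul_add, ← mul_assoc,
                    ← ENNReal.ofReal_mul (p := (t ^ 2)⁻¹) (q := t ^ 2) (by positivity),
                    inv_mul_cancel₀ (by positivity), ENNReal.ofReal_one, one_mul]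
                  congr 2
                  ring
      _ ≤ (∫⁻ t in Ioi (s (n + 1)), ENNReal.ofReal ((t ^ 2)⁻¹) *
            ENNReal.ofReal (4 * c ^ 2 * m (n + 1) ^ 2 * s (n + 1))) +
          ∫⁻ t in Ioc (s (n + 1)) (s n), ENNReal.ofReal (8 * c ^ 2 * m n ^ 2 * (s n)⁻¹) := by
          rw [lintegral_add_right _ measurable_const]
          gcongr
          exact Ioc_subset_Ioi_self
      _ ≤ ENNReal.ofReal (4 * c ^ 2 * m (n + 1) ^ 2) + ENNReal.ofReal (8 * c ^ 2 * m n ^ 2) := by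
          refine add_le_add (le_of_eq ?_) ?_
          · rw [lintegral_mul_const' _ _ ENNReal.ofReal_ne_top, lintegral_Ioi_inv_sq (hs _),
              ← ENNReal.ofReal_mul (inv_nonneg.2 (hs _).le)]
            congr 1
            field_simp [(hs (n + 1)).ne']
          · rw [setLIntegral_const, Real.volume_Ioc, ← ENNReal.ofReal_mul
              (by have := inv_nonneg.2 (hs n).le; positivity)]
            refine ENNReal.ofReal_le_ofReal ?_
            rw [mul_assoc]
            refine mul_le_of_le_one_right (by positivity) ?_
            rw [inv_mul_le_iff₀ (hs n)]
            linarith [hs (n + 1)]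
      _ ≤ _ := by
          rw [← ENNReal.ofReal_add (by positivity) (by positivity)]
          refine ENNReal.ofReal_le_ofReal ?_
          have : m (n + 1) ^ 2 ≤ m n ^ 2 := pow_le_pow_left₀ (hm _) (hm1 n) 2
          nlinarith [mul_le_mul_of_nonneg_left this (sq_nonneg c)]
  have cover : Ioi (0 : ℝ) ⊆ Ioi (s 0) ∪ ⋃ n, Ioc (s (n + 1)) (s n) := by
    intro t ht
    by_cases h0 : s 0 < t
    · exact Or.inl h0
    obtain ⟨n, -, hn⟩ := exists_mem_Ioc_of_le_div hs hs2 ht 0 (not_lt.1 h0)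
    exact Or.inr (mem_iUnion.2 ⟨n, hn⟩)
  calc _ ≤ ∫⁻ t in Ioi (s 0) ∪ ⋃ n, Ioc (s (n + 1)) (s n),
        ENNReal.ofReal ((t ^ 2)⁻¹) * sobolevKSq Ω t q := lintegral_mono_set cover
    _ ≤ ENNReal.ofReal (4 * c ^ 2 * m 0 ^ 2) + ∑' n, ENNReal.ofReal (12 * c ^ 2 * m n ^ 2) :=
        (lintegral_union_le _ _ _).trans (add_le_add first
          ((lintegral_iUnion_le _ _).trans (ENNReal.tsum_le_tsum piece)))
    _ ≤ ENNReal.ofReal (4 * c ^ 2) * ∑' n, ENNReal.ofReal (m n ^ 2) +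
        ENNReal.ofReal (12 * c ^ 2) * ∑' n, ENNReal.ofReal (m n ^ 2) := by
        refine add_le_add ?_ (le_of_eq ?_)
        · rw [ENNReal.ofReal_mul (by positivity)]
          exact mul_le_mul_right (ENNReal.le_tsum 0) _
        · rw [← ENNReal.tsum_mul_left]
          congr 1 with n
          rw [ENNReal.ofReal_mul (by positivity)]
    _ = _ := by
        rw [← add_mul, ← ENNReal.ofReal_add (by positivity) (by positivity)]
        congr 2
        ring

/-! ### Boundary layers -/

/-- The function which is `1` up to distance `s / 2` from `K`, `0` from distance `s` on, and affine
in the distance between. -/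
noncomputable def layerCutoff (K : Set E3) (s : ℝ) (x : E3) : ℝ :=
  max 0 (min 1 (2 - 2 / s * Metric.infDist x K))

section layerCutoff

variable {K : Set E3} {s : ℝ}

lemma layerCutoff_nonneg (K : Set E3) (s : ℝ) (x : E3) : 0 ≤ layerCutoff K s x := le_max_left _ _

lemma layerCutoff_le_one (K : Set E3) (s : ℝ) (x : E3) : layerCutoff K s x ≤ 1 :=
  max_le zero_le_one (min_le_left _ _)

lemma layerCutoff_eq_zero (hs : 0 < s) {x : E3} (hx : s ≤ Metric.infDist x K) :
    layerCutoff K s x = 0 := by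
  refine max_eq_left ((min_le_right _ _).trans ?_)
  rw [sub_nonpos, div_mul_eq_mul_div, le_div_iff₀ hs]
  linarith

lemma layerCutoff_eq_one (hs : 0 < s) {x : E3} (hx : Metric.infDist x K ≤ s / 2) :
    layerCutoff K s x = 1 := by
  have : 2 / s * Metric.infDist x K ≤ 1 := by
    rw [div_mul_eq_mul_div, div_le_iff₀ hs]
    linarith
  rw [layerCutoff, min_eq_left (by linarith), max_eq_right zero_le_one]

lemma abs_layerCutoff_sub_le (hs : 0 < s) (x y : E3) :
    |layerCutoff K s x - layerCutoff K s y| ≤ 2 / s * dist x y := by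
  have h1 : |Metric.infDist x K - Metric.infDist y K| ≤ dist x y := by
    simpa [Real.dist_eq] using (Metric.lipschitz_infDist_pt K).dist_le_mul x y
  unfold layerCutoff
  refine (abs_max_sub_max_le_max _ _ _ _).trans ?_
  rw [sub_self, abs_zero]
  refine max_le (by positivity) ((abs_min_sub_min_le_max _ _ _ _).trans ?_)
  rw [sub_self, abs_zero]
  refine max_le (by positivity) ?_
  rw [show ∀ a b : ℝ, 2 - 2 / s * a - (2 - 2 / s * b) = -(2 / s * (a - b)) from fun a b => by ring,
    abs_neg, abs_mul, abs_of_pos (by positivity : 0 < 2 / s)]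
  gcongr

variable {D : E3 → ℝ} {m L : ℝ}

lemma abs_layerCutoff_mul_le (hD : ∀ x, |D x| ≤ m) (x : E3) : |layerCutoff K s x * D x| ≤ m := by
  rw [abs_mul, abs_of_nonneg (layerCutoff_nonneg K s x)]
  exact (mul_le_of_le_one_left (abs_nonneg _) (layerCutoff_le_one K s x)).trans (hD x)

/-- By the product rule the cutoff contributes slope `2 m / s` and `D` contributes `L ≤ m / s`. The
layer is thin enough for the slope of `D` not to matter. -/
lemma lipschitzWith_layerCutoff_mul (hs : 0 < s) (hD : ∀ x, |D x| ≤ m)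
    (hDL : ∀ x y, |D x - D y| ≤ L * dist x y) (hsL : s * L ≤ m) :
    LipschitzWith (Real.toNNReal (3 * m / s)) (fun x => layerCutoff K s x * D x) := by
  have hm : 0 ≤ m := (abs_nonneg _).trans (hD 0)
  refine LipschitzWith.of_dist_le_mul fun x y => ?_
  rw [Real.coe_toNNReal _ (by positivity), Real.dist_eq]
  have hL : L ≤ m / s := by rw [le_div_iff₀ hs]; linarith
  calc _ = |(layerCutoff K s x - layerCutoff K s y) * D x + layerCutoff K s y * (D x - D y)| := by
        congr 1; ring
    _ ≤ 2 / s * dist x y * m + 1 * (m / s * dist x y) := by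
        refine (abs_add_le _ _).trans (add_le_add ?_ ?_)
        · rw [abs_mul]
          exact mul_le_mul (abs_layerCutoff_sub_le hs x y) (hD x) (abs_nonneg _) (by positivity)
        · rw [abs_mul, abs_of_nonneg (layerCutoff_nonneg K s y)]
          refine mul_le_mul (layerCutoff_le_one K s y) ((hDL x y).trans ?_) (abs_nonneg _)
            zero_le_one
          gcongr
    _ = _ := by ring

lemma eLpNorm_two_le_of_bound_of_support {α E : Type*} [NormedAddCommGroup E] [MeasurableSpace α]
    {μ : Measure α} {f : α → E} {T : Set α} (hT : MeasurableSet T) {M V : ℝ}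
    (hV : 0 ≤ V) (hf : ∀ x, ‖f x‖ ≤ M) (hfT : ∀ x ∉ T, f x = 0) (hμ : μ T ≤ ENNReal.ofReal V) :
    eLpNorm f 2 μ ≤ ENNReal.ofReal (M * √V) := by
  have h : f = T.indicator f := by
    ext x
    by_cases hx : x ∈ T
    · simp [hx]
    · simp [hx, hfT x hx]
  rw [h, eLpNorm_indicator_eq_eLpNorm_restrict hT]
  refine (eLpNorm_le_of_ae_bound (Eventually.of_forall hf)).trans ?_
  rw [Measure.restrict_apply_univ, mul_comm M, ENNReal.ofReal_mul (Real.sqrt_nonneg V)]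
  refine mul_le_mul_left ?_ _
  rw [Real.sqrt_eq_rpow, ← ENNReal.ofReal_rpow_of_nonneg hV (by norm_num)]
  have : (2 : ℝ≥0∞).toReal⁻¹ = 1 / 2 := by norm_num
  rw [this]
  gcongr

variable {Ω : Set E3} {C : ℝ}

lemma measurableSet_infDist_le (K : Set E3) (s : ℝ) :
    MeasurableSet {x | Metric.infDist x K ≤ s} :=
  (isClosed_le (Metric.continuous_infDist_pt K) continuous_const).measurableSet

lemma eLpNorm_layerCutoff_mul_le (hs : 0 < s) (hC : 0 ≤ C)
    (hvol : volume (Ω ∩ {x | Metric.infDist x K ≤ s}) ≤ ENNReal.ofReal (C * s))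
    (hD : ∀ x, |D x| ≤ m) :
    eLpNorm (fun x => layerCutoff K s x * D x) 2 (volume.restrict Ω) ≤
      ENNReal.ofReal (6 * √C * (m * √s)) := by
  have hm : 0 ≤ m := (abs_nonneg _).trans (hD 0)
  refine (eLpNorm_two_le_of_bound_of_support (measurableSet_infDist_le K s)
    (mul_nonneg hC hs.le) (abs_layerCutoff_mul_le hD) (fun x hx => ?_) ?_).trans
    (ENNReal.ofReal_le_ofReal ?_)
  · rw [layerCutoff_eq_zero hs (not_le.1 hx).le, zero_mul]
  · rwa [Measure.restrict_apply (measurableSet_infDist_le K s), inter_comm]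
  · rw [Real.sqrt_mul hC]
    -- The factor `6` is slack here; it lets the gradient estimate share the constant.
    have : 0 ≤ √C * (m * √s) := by positivity
    nlinarith

/-- The gradient is at most `2 * (3 m / s)` and vanishes off a layer of volume `C s`, whence the
factor `6`. -/
lemma eLpNorm_partialDerivs_layerCutoff_mul_le (hs : 0 < s) (hC : 0 ≤ C)
    (hvol : volume (Ω ∩ {x | Metric.infDist x K ≤ s}) ≤ ENNReal.ofReal (C * s))
    (hD : ∀ x, |D x| ≤ m) (hDL : ∀ x y, |D x - D y| ≤ L * dist x y) (hsL : s * L ≤ m) :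
    eLpNorm (partialDerivs fun x => layerCutoff K s x * D x) 2 (volume.restrict Ω) ≤
      ENNReal.ofReal (6 * √C * (m / √s)) := by
  have hm : 0 ≤ m := (abs_nonneg _).trans (hD 0)
  refine (eLpNorm_two_le_of_bound_of_support (measurableSet_infDist_le K s)
    (mul_nonneg hC hs.le) (norm_partialDerivs_le (lipschitzWith_layerCutoff_mul hs hD hDL hsL))
    (fun x hx => ?_) ?_).trans (ENNReal.ofReal_le_ofReal (le_of_eq ?_))
  · refine partialDerivs_eq_zero ?_
    have : ∀ᶠ z in 𝓝 x, s < Metric.infDist z K :=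
      (Metric.continuous_infDist_pt K).continuousAt.eventually_const_lt (not_le.1 hx)
    filter_upwards [this] with z hz
    rw [layerCutoff_eq_zero hs hz.le, zero_mul, Pi.zero_apply]
  · rwa [Measure.restrict_apply (measurableSet_infDist_le K s), inter_comm]
  · rw [Real.coe_toNNReal _ (by positivity), Real.sqrt_mul hC]
    have : 0 < √s := Real.sqrt_pos.2 hs
    field_simp
    rw [Real.sq_sqrt hs.le]
    ring

end layerCutoff

/-! ### The choice of the scales -/

/-- Compactness takes the place of a cone condition: for `y` within `s / 2` of a boundary point `x`,
the ball of radius `s` about `y` contains the ball of radius `s / 2` about `x`, which meets `Ω` in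
positive volume. -/
lemma exists_volume_ball_inter_ge {Ω : Set E3} (hΩ : IsOpen Ω) (hK : IsCompact (frontier Ω))
    {s : ℝ} (hs : 0 < s) :
    ∃ δ : ℝ, 0 < δ ∧ ∀ y ∈ frontier Ω, ENNReal.ofReal δ ≤ volume (Metric.ball y s ∩ Ω) := by
  refine hK.induction_on (p := fun S => ∃ δ : ℝ, 0 < δ ∧
    ∀ y ∈ S, ENNReal.ofReal δ ≤ volume (Metric.ball y s ∩ Ω)) ⟨1, one_pos, by simp⟩
    (fun S T hST ⟨δ, hδ, h⟩ => ⟨δ, hδ, fun y hy => h y (hST hy)⟩) ?_ ?_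
  · rintro S T ⟨δ, hδ, h⟩ ⟨δ', hδ', h'⟩
    refine ⟨min δ δ', lt_min hδ hδ', ?_⟩
    rintro y (hy | hy)
    · exact (ENNReal.ofReal_le_ofReal (min_le_left _ _)).trans (h y hy)
    · exact (ENNReal.ofReal_le_ofReal (min_le_right _ _)).trans (h' y hy)
  · intro x hx
    have hpos : 0 < volume (Metric.ball x (s / 2) ∩ Ω) :=
      (Metric.isOpen_ball.inter hΩ).measure_pos _ (mem_closure_iff_nhds.1 hx.1 _
        (Metric.ball_mem_nhds x (by positivity)))
    have hfin : volume (Metric.ball x (s / 2) ∩ Ω) ≠ ∞ :=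
      ((measure_mono inter_subset_left).trans_lt measure_ball_lt_top).ne
    refine ⟨Metric.ball x (s / 2), mem_nhdsWithin_of_mem_nhds
      (Metric.ball_mem_nhds x (by positivity)), _, ENNReal.toReal_pos hpos.ne' hfin, fun y hy => ?_⟩
    rw [ENNReal.ofReal_toReal hfin]
    refine measure_mono (inter_subset_inter_left _ (Metric.ball_subset_ball' ?_))
    rw [Metric.mem_ball, dist_comm] at hy
    linarith

lemma exists_lacunary_seq {l : ℕ → ℝ} (hl : ∀ n, 0 < l n) {f : ℕ → ℝ → ℝ}
    (hf : ∀ n t, 0 < t → 0 < f n t) :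
    ∃ s : ℕ → ℝ, ∀ n, 0 < s n ∧ s n ≤ l n ∧ s (n + 1) ≤ f n (s n) := by
  let s : ℕ → ℝ := fun n => Nat.rec (l 0) (fun n t => min (l (n + 1)) (f n t)) n
  have hpos : ∀ n, 0 < s n := fun n => by
    induction n with
    | zero => exact hl 0
    | succ n ih => exact lt_min (hl _) (hf _ _ ih)
  refine ⟨s, fun n => ⟨hpos n, ?_, min_le_right _ _⟩⟩
  cases n with
  | zero => exact le_rfl
  | succ n => exact min_le_left _ _

/-- The width `s (n + 1)` is chosen after `s n`, so its layer, of volume at most `C * s (n + 1)`,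
can be made small against the least volume `δ (s n)` of a boundary ball of radius `s n`. -/
lemma exists_scales {Ω : Set E3} (hΩ : IsOpen Ω) (hK : IsCompact (frontier Ω)) {C : ℝ} (hC : 0 < C)
    (hvol : ∀ s : ℝ, 0 < s → s ≤ 1 →
      volume (Ω ∩ {x | Metric.infDist x (frontier Ω) ≤ s}) ≤ ENNReal.ofReal (C * s))
    {m L : ℕ → ℝ} (hm : ∀ n, 0 < m n) (hL : ∀ n, 0 ≤ L n) :
    ∃ s : ℕ → ℝ, (∀ n, 0 < s n) ∧ (∀ n, s n ≤ 1) ∧ (∀ n, s n * L n ≤ m n) ∧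
      (∀ n, s (n + 1) ≤ s n / 16) ∧ ∀ n, ∀ y ∈ frontier Ω,
        volume (Ω ∩ {x | Metric.infDist x (frontier Ω) ≤ s (n + 1)}) ≤
          2⁻¹ ^ (n + 1) * volume (Metric.ball y (s n) ∩ Ω) := by
  choose! δ hδ hδ' using fun (s : ℝ) (hs : 0 < s) => exists_volume_ball_inter_ge hΩ hK hs
  obtain ⟨s, hs⟩ := exists_lacunary_seq (l := fun n => min 1 (m n / (L n + 1)))
    (f := fun n t => min (t / 16) ((1 / 2) ^ (n + 1) * δ t / C))
    (fun n => lt_min one_pos (div_pos (hm n) (by linarith [hL n])))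
    (fun n t ht => lt_min (by positivity) (by have := hδ t ht; positivity))
  have h1 : ∀ n, s n ≤ 1 := fun n => (hs n).2.1.trans (min_le_left _ _)
  refine ⟨s, fun n => (hs n).1, h1, fun n => ?_, fun n => (hs n).2.2.trans (min_le_left _ _),
    fun n y hy => ?_⟩
  · have h := (hs n).2.1.trans (min_le_right _ _)
    rw [le_div_iff₀ (by linarith [hL n])] at h
    linarith [(hs n).1]
  · refine (hvol _ (hs _).1 (h1 _)).trans ?_
    have h := (hs n).2.2.trans (min_le_right _ _)
    rw [le_div_iff₀ hC] at h
    calc _ ≤ ENNReal.ofReal ((1 / 2) ^ (n + 1) * δ (s n)) :=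
          ENNReal.ofReal_le_ofReal (by linarith)
      _ = 2⁻¹ ^ (n + 1) * ENNReal.ofReal (δ (s n)) := by
          rw [ENNReal.ofReal_mul (by positivity), ENNReal.ofReal_pow (by positivity), one_div,
            ENNReal.ofReal_inv_of_pos two_pos, ENNReal.ofReal_ofNat]
      _ ≤ _ := mul_le_mul_right (hδ' _ (hs n).1 y hy) _

/-! ### The extension -/

/-- The sum of the increments of the sequence `A`, the `n`-th one cut off at distance `s n` from
`K`. -/
noncomputable def layeredSeries (K : Set E3) (s : ℕ → ℝ) (A : ℕ → E3 → ℝ) (x : E3) : ℝ :=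
  ∑' n, layerCutoff K (s n) x * (A (n + 1) x - A n x)

section layeredSeries

variable {K Ω : Set E3} {s m : ℕ → ℝ} {A : ℕ → E3 → ℝ}

lemma layerCutoff_eventually_eq_zero (hs : ∀ n, 0 < s n) (hs2 : ∀ n, s (n + 1) ≤ s n / 16) {x : E3}
    (hx : 0 < Metric.infDist x K) : ∃ N, ∀ n, N ≤ n → layerCutoff K (s n) x = 0 := by
  obtain ⟨N, hN⟩ := eventually_atTop.1
    ((tendsto_zero_of_le_div hs hs2).eventually_le_const hx)
  exact ⟨N, fun n hn => layerCutoff_eq_zero (hs n) (hN n hn)⟩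

lemma layeredSeries_eq_sum {x : E3} {N : ℕ} (hN : ∀ n, N ≤ n → layerCutoff K (s n) x = 0) :
    layeredSeries K s A x =
      ∑ n ∈ Finset.range N, layerCutoff K (s n) x * (A (n + 1) x - A n x) :=
  tsum_eq_sum fun n hn => by rw [hN n (by simpa using hn), zero_mul]

lemma tendsto_layeredSeries (hs : ∀ n, 0 < s n) (hs2 : ∀ n, s (n + 1) ≤ s n / 16) {x : E3}
    (hx : 0 < Metric.infDist x K) :
    Tendsto (fun N => ∑ n ∈ Finset.range N, layerCutoff K (s n) x * (A (n + 1) x - A n x)) atTop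
      (𝓝 (layeredSeries K s A x)) := by
  obtain ⟨N, hN⟩ := layerCutoff_eventually_eq_zero hs hs2 hx
  refine tendsto_const_nhds.congr' ?_
  filter_upwards [eventually_ge_atTop N] with M hM
  exact layeredSeries_eq_sum fun n hn => hN n (hM.trans hn)

lemma infDist_frontier_pos (hΩ : IsOpen Ω) (hne : (frontier Ω).Nonempty) {x : E3} (hx : x ∈ Ω) :
    0 < Metric.infDist x (frontier Ω) :=
  (isClosed_frontier.notMem_iff_infDist_pos hne).1 fun h => by
    rw [hΩ.frontier_eq] at h
    exact h.2 hx

/-- For `k < n` the cutoff is `1`, since `s n ≤ s k / 16`, and these terms telescope to `A n x`. The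
terms `n` and `n + 1` are bounded by their size. The term `n + 1` cannot join the tail: the volume
of its layer is compared with balls of radius `s n`, while the radius of interest may be as small as
`s (n + 1)`. -/
lemma enorm_layeredSeries_sub_le (hs : ∀ n, 0 < s n) (hs2 : ∀ n, s (n + 1) ≤ s n / 16)
    (hA0 : ∀ x, A 0 x = 0) (hAm : ∀ n x, |A (n + 1) x - A n x| ≤ m n) {x : E3}
    (hx : 0 < Metric.infDist x K) {n : ℕ} (hxn : Metric.infDist x K ≤ s n) (a : ℝ) :
    ‖layeredSeries K s A x - a‖ₑ ≤ ENNReal.ofReal (|A n x - a| + m n + m (n + 1)) +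
      ∑' j, ‖layerCutoff K (s (n + 2 + j)) x * (A (n + 2 + j + 1) x - A (n + 2 + j) x)‖ₑ := by
  obtain ⟨N, hN⟩ := layerCutoff_eventually_eq_zero hs hs2 hx
  rw [layeredSeries_eq_sum (N := n + 2 + N) fun k hk => hN k (by omega), Finset.sum_range_add,
    Finset.sum_range_succ, Finset.sum_range_succ]
  have h1 : ∑ k ∈ Finset.range n, layerCutoff K (s k) x * (A (k + 1) x - A k x) = A n x := by
    rw [← sub_zero (A n x), ← hA0 x, ← Finset.sum_range_sub (fun k => A k x)]
    refine Finset.sum_congr rfl fun k hk => ?_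
    rw [layerCutoff_eq_one (hs k), one_mul]
    have := antitone_of_le_div hs hs2 (Nat.succ_le_of_lt (Finset.mem_range.1 hk))
    simp only [Nat.succ_eq_add_one] at this
    linarith [hs2 k, hs k]
  rw [h1]
  set u : ℕ → ℝ := fun k => layerCutoff K (s k) x * (A (k + 1) x - A k x)
  have hu : ∀ k, |u k| ≤ m k := fun k => abs_layerCutoff_mul_le (hAm k) x
  calc _ = ‖(A n x - a + u n + u (n + 1)) + ∑ j ∈ Finset.range N, u (n + 2 + j)‖ₑ := by
        congr 1; ring
    _ ≤ ‖A n x - a + u n + u (n + 1)‖ₑ + ‖∑ j ∈ Finset.range N, u (n + 2 + j)‖ₑ := enorm_add_le _ _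
    _ ≤ _ := by
        refine add_le_add ?_ ((enorm_sum_le _ _).trans (ENNReal.sum_le_tsum _))
        rw [Real.enorm_eq_ofReal_abs]
        refine ENNReal.ofReal_le_ofReal ((abs_add_three _ _ _).trans ?_)
        linarith [hu n, hu (n + 1)]

lemma setLAverage_layeredSeries_le (hΩ : IsOpen Ω) (hne : (frontier Ω).Nonempty)
    (hs : ∀ n, 0 < s n) (hs2 : ∀ n, s (n + 1) ≤ s n / 16)
    (hA0 : ∀ x, A 0 x = 0) (hAc : ∀ n, Continuous (A n))
    (hAm : ∀ n x, |A (n + 1) x - A n x| ≤ m n) (hm1 : ∀ n, m n ≤ 1) {L : ℕ → ℝ}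
    (hAL : ∀ n x y, |A n x - A n y| ≤ L n * dist x y) (hL : ∀ n, 0 ≤ L n)
    (hsL : ∀ n, s n * L n ≤ m n)
    (hvol : ∀ n, ∀ y ∈ frontier Ω,
        volume (Ω ∩ {x | Metric.infDist x (frontier Ω) ≤ s (n + 1)}) ≤
          2⁻¹ ^ (n + 1) * volume (Metric.ball y (s n) ∩ Ω)) {y : E3} (hy : y ∈ frontier Ω) (a : ℝ)
    {n : ℕ} {r : ℝ} (hr : s (n + 1) ≤ r) (hr' : r ≤ s n) :
    ⨍⁻ x in Metric.ball y r ∩ Ω, ‖layeredSeries (frontier Ω) s A x - a‖ₑ ∂volume ≤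
      ENNReal.ofReal (|A n y - a| + 2 * m n + m (n + 1)) + 2⁻¹ ^ n := by
  set B := Metric.ball y r ∩ Ω
  have hB : MeasurableSet B := measurableSet_ball.inter hΩ.measurableSet
  set u : ℕ → E3 → ℝ := fun k x => layerCutoff (frontier Ω) (s k) x * (A (k + 1) x - A k x)
  have hcut : ∀ k, Continuous (layerCutoff (frontier Ω) (s k)) := fun k => by
    have := Metric.continuous_infDist_pt (frontier Ω)
    unfold layerCutoff
    fun_prop
  have hu : ∀ k, Measurable (u k) := fun k =>
    ((hcut k).mul ((hAc (k + 1)).sub (hAc k))).measurable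
  have hint : ∀ j, ∫⁻ x in B, ‖u (n + 2 + j) x‖ₑ ≤ 2⁻¹ ^ (j + 1) * (2⁻¹ ^ n * volume B) := fun j => by
    have hTm := measurableSet_infDist_le (frontier Ω) (s (n + 2 + j))
    calc _ ≤ ∫⁻ x in B, {x | Metric.infDist x (frontier Ω) ≤ s (n + 2 + j)}.indicator 1 x := by
          refine lintegral_mono fun x => ?_
          by_cases hx : x ∈ {x | Metric.infDist x (frontier Ω) ≤ s (n + 2 + j)}
          · rw [indicator_of_mem hx, Pi.one_apply, Real.enorm_eq_ofReal_abs]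
            exact ENNReal.ofReal_le_one.2
              ((abs_layerCutoff_mul_le (hAm _) x).trans (hm1 _))
          · simp only [u]
            rw [layerCutoff_eq_zero (hs _) (not_le.1 hx).le]
            simp
      _ ≤ volume (Ω ∩ {x | Metric.infDist x (frontier Ω) ≤ s (n + 1 + j + 1)}) := by
          rw [lintegral_indicator_one hTm, Measure.restrict_apply hTm, inter_comm,
            show n + 2 + j = n + 1 + j + 1 by omega]
          exact measure_mono (inter_subset_inter_left _ inter_subset_right)
      -- The comparison ball has radius `s (n + 1 + j) ≤ s (n + 1) ≤ r`, so it lies in the ball over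
      -- which the mean is taken.
      _ ≤ 2⁻¹ ^ (n + 1 + j + 1) * volume (Metric.ball y (s (n + 1 + j)) ∩ Ω) := hvol _ y hy
      _ ≤ 2⁻¹ ^ (n + (j + 1)) * volume B := by
          refine mul_le_mul' (pow_le_pow_right_of_le_one' (by norm_num) (by omega)) (measure_mono
            (inter_subset_inter_left _ (Metric.ball_subset_ball (le_trans ?_ hr))))
          exact antitone_of_le_div hs hs2 (by omega)
      _ = _ := by rw [pow_add]; ring
  rw [setLAverage_eq]
  refine ENNReal.div_le_of_le_mul ?_
  calc _ ≤ ∫⁻ x in B, (ENNReal.ofReal (|A n y - a| + 2 * m n + m (n + 1)) +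
          ∑' j, ‖u (n + 2 + j) x‖ₑ) := by
        refine setLIntegral_mono' hB fun x hx => ?_
        have hd : dist x y ≤ s n := (Metric.mem_ball.1 hx.1).le.trans hr'
        refine (enorm_layeredSeries_sub_le hs hs2 hA0 hAm (infDist_frontier_pos hΩ hne hx.2)
          ((Metric.infDist_le_dist_of_mem hy).trans hd) a).trans
          (add_le_add_left (ENNReal.ofReal_le_ofReal ?_) _)
        -- This oscillation accounts for the second `m n` in the bound.
        have h1 : |A n x - A n y| ≤ m n := (hAL n x y).trans (by
          have := mul_le_mul_of_nonneg_left hd (hL n)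
          linarith [hsL n])
        have h2 : |A n x - a| ≤ |A n x - A n y| + |A n y - a| := abs_sub_le _ _ _
        linarith
    _ = ENNReal.ofReal (|A n y - a| + 2 * m n + m (n + 1)) * volume B +
          ∑' j, ∫⁻ x in B, ‖u (n + 2 + j) x‖ₑ := by
        rw [lintegral_add_left measurable_const, setLIntegral_const,
          lintegral_tsum fun j => (hu _).enorm.aemeasurable]
    _ ≤ ENNReal.ofReal (|A n y - a| + 2 * m n + m (n + 1)) * volume B + 2⁻¹ ^ n * volume B := by
        refine add_le_add_right ((ENNReal.tsum_le_tsum hint).trans ?_) _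
        rw [ENNReal.tsum_mul_right, ENNReal.tsum_geometric_add_one]
        simp [ENNReal.inv_mul_cancel]
    _ = _ := by rw [add_mul]

lemma hasBoundaryTrace_layeredSeries (hΩ : IsOpen Ω) (hne : (frontier Ω).Nonempty)
    (hs : ∀ n, 0 < s n) (hs2 : ∀ n, s (n + 1) ≤ s n / 16)
    (hA0 : ∀ x, A 0 x = 0) (hAc : ∀ n, Continuous (A n))
    (hAm : ∀ n x, |A (n + 1) x - A n x| ≤ m n) (hm1 : ∀ n, m n ≤ 1)
    (hm0 : Tendsto m atTop (𝓝 0)) {L : ℕ → ℝ}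
    (hAL : ∀ n x y, |A n x - A n y| ≤ L n * dist x y) (hL : ∀ n, 0 ≤ L n)
    (hsL : ∀ n, s n * L n ≤ m n)
    (hvol : ∀ n, ∀ y ∈ frontier Ω,
        volume (Ω ∩ {x | Metric.infDist x (frontier Ω) ≤ s (n + 1)}) ≤
          2⁻¹ ^ (n + 1) * volume (Metric.ball y (s n) ∩ Ω))
    {σ : Measure E3} (hσ : ∀ᵐ y ∂σ, y ∈ frontier Ω) {p : E3 → ℝ}
    (hp : ∀ᵐ y ∂σ, Tendsto (fun n => A n y) atTop (𝓝 (p y))) :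
    HasBoundaryTrace Ω σ (layeredSeries (frontier Ω) s A) p := by
  filter_upwards [hσ, hp] with y hy hpy
  have herr : Tendsto (fun n => ENNReal.ofReal (|A n y - p y| + 2 * m n + m (n + 1)) +
      (2⁻¹ : ℝ≥0∞) ^ n) atTop (𝓝 0) := by
    have h1 : Tendsto (fun n => |A n y - p y| + 2 * m n + m (n + 1)) atTop (𝓝 0) := by
      have h := ((hpy.sub_const (p y)).abs.add (hm0.const_mul 2)).add
        (hm0.comp (tendsto_add_atTop_nat 1))
      simpa using h
    have h2 := ENNReal.tendsto_ofReal h1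
    have h3 : Tendsto (fun n => (2⁻¹ : ℝ≥0∞) ^ n) atTop (𝓝 0) :=
      ENNReal.tendsto_pow_atTop_nhds_zero_of_lt_one (by norm_num)
    simpa using h2.add h3
  rw [ENNReal.tendsto_nhds_zero]
  intro ε hε
  obtain ⟨N, hN⟩ := eventually_atTop.1 (ENNReal.tendsto_nhds_zero.1 herr ε hε)
  have hmem : Ioo 0 (s N) ∈ 𝓝[>] (0 : ℝ) := Ioo_mem_nhdsGT (hs N)
  filter_upwards [hmem] with r hr
  obtain ⟨n, hn, hrn⟩ := exists_mem_Ioc_of_le_div hs hs2 hr.1 N hr.2.le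
  exact (setLAverage_layeredSeries_le hΩ hne hs hs2 hA0 hAc hAm hm1 hAL hL hsL hvol hy (p y)
    hrn.1.le hrn.2).trans (hN n hn)

end layeredSeries

/-! ### Extensions of arbitrarily small norm for a general open set -/

/-- Smooth compactly supported functions are dense in `L²`, and a subsequence converges almost
everywhere. No rate is required, as `slowApprox` imposes its own step sizes. -/
lemma exists_lipschitz_tendsto_ae {σ : Measure E3} [IsFiniteMeasure σ] {p : E3 → ℝ}
    (hp : MemLp p 2 σ) :
    ∃ P : ℕ → E3 → ℝ, (∀ n, ∃ L, LipschitzWith L (P n)) ∧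
      ∀ᵐ y ∂σ, Tendsto (fun n => P n y) atTop (𝓝 (p y)) := by
  choose g hgc hg hgp using fun n : ℕ => hp.exist_eLpNorm_sub_le (by norm_num) (by norm_num)
    (ε := 1 / ((n : ℝ) + 1)) (by positivity)
  have hlim : Tendsto (fun n => eLpNorm (g n - p) 2 σ) atTop (𝓝 0) := by
    refine tendsto_of_tendsto_of_tendsto_of_le_of_le tendsto_const_nhds ?_ (fun _ => zero_le)
      (fun n => (eLpNorm_sub_comm _ _ _ _).trans_le (hgp n))
    simpa using ENNReal.tendsto_ofReal tendsto_one_div_add_atTop_nhds_zero_nat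
  obtain ⟨ns, -, hns⟩ := (tendstoInMeasure_of_tendsto_eLpNorm (by norm_num)
    (fun n => (hg n).continuous.aestronglyMeasurable) hp.1 hlim).exists_seq_tendsto_ae
  exact ⟨fun n => g (ns n), fun n => (hg _).lipschitzWith_of_hasCompactSupport (hgc _) (by simp),
    hns⟩

/-- `H^{1/2}` is the critical space for traces: boundary data in `L²` are attained by functions
whose `H^{1/2}` norm is as small as one likes. -/
theorem exists_extension_lintegral_sobolevKSq_le {Ω : Set E3} (hΩ : IsOpen Ω)
    (hK : IsCompact (frontier Ω)) (hne : (frontier Ω).Nonempty) {C : ℝ} (hC : 0 < C)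
    (hvol : ∀ s : ℝ, 0 < s → s ≤ 1 →
      volume (Ω ∩ {x | Metric.infDist x (frontier Ω) ≤ s}) ≤ ENNReal.ofReal (C * s))
    {σ : Measure E3} [IsFiniteMeasure σ] (hσ : ∀ᵐ y ∂σ, y ∈ frontier Ω) {p : E3 → ℝ}
    (hp : MemLp p 2 σ) {ε : ℝ} (hε : 0 < ε) :
    ∃ q : E3 → ℝ, MemLp q 2 (volume.restrict Ω) ∧ HasBoundaryTrace Ω σ q p ∧
      ∫⁻ t in Ioi (0 : ℝ), ENNReal.ofReal ((t ^ 2)⁻¹) * sobolevKSq Ω t q ≤ ENNReal.ofReal ε := by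
  have hsum : Summable fun n : ℕ => (1 / ((n : ℝ) + 1)) ^ 2 := by
    have := (summable_nat_add_iff 1).2 (Real.summable_one_div_nat_pow.2 one_lt_two)
    refine this.congr fun n => ?_
    push_cast
    rw [one_div_pow]
  set S := ∑' n : ℕ, (1 / ((n : ℝ) + 1)) ^ 2
  have hS : 0 ≤ S := tsum_nonneg fun n => by positivity
  set c := 6 * √C
  have hc : 0 ≤ c := by positivity
  obtain ⟨η, hη, hη1, hηε⟩ : ∃ η : ℝ, 0 < η ∧ η ≤ 1 ∧ 16 * c ^ 2 * (η * S) ≤ ε := by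
    refine ⟨min 1 (ε / (16 * c ^ 2 * S + 1)), lt_min one_pos (by positivity), min_le_left _ _, ?_⟩
    have h := min_le_right 1 (ε / (16 * c ^ 2 * S + 1))
    have h0 : 0 < min 1 (ε / (16 * c ^ 2 * S + 1)) := lt_min one_pos (by positivity)
    rw [le_div_iff₀ (by positivity)] at h
    linarith
  -- Harmonic steps have a divergent sum, so `p` is reached, and summable squares, so the norm is
  -- finite. The factor `η` makes it small without affecting the divergence.
  set m : ℕ → ℝ := fun n => η * (1 / ((n : ℝ) + 1)) with hmdef
  have hm : ∀ n, 0 < m n := fun n => by positivity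
  have hm1 : ∀ n, m (n + 1) ≤ m n := fun n =>
    mul_le_mul_of_nonneg_left (one_div_le_one_div_of_le (by positivity) (by push_cast; linarith))
      hη.le
  have hm2 : ∀ n, m n ≤ 2 * m (n + 1) := fun n => by
    simp only [hmdef]
    rw [mul_left_comm]
    refine mul_le_mul_of_nonneg_left ?_ hη.le
    rw [mul_one_div, div_le_div_iff₀ (by positivity) (by positivity)]
    push_cast
    linarith [(Nat.cast_nonneg n : (0 : ℝ) ≤ n)]
  have hmle : ∀ n, m n ≤ 1 := fun n =>
    mul_le_one₀ hη1 (by positivity) (by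
      rw [div_le_one (by positivity)]
      linarith [(Nat.cast_nonneg n : (0 : ℝ) ≤ n)])
  have hm0 : Tendsto m atTop (𝓝 0) := by
    simpa [hmdef] using (tendsto_one_div_add_atTop_nhds_zero_nat (𝕜 := ℝ)).const_mul η
  have hdiv : Tendsto (fun n => ∑ i ∈ Finset.range n, m i) atTop atTop := by
    simp only [hmdef, ← Finset.mul_sum]
    exact Real.tendsto_sum_range_one_div_nat_succ_atTop.const_mul_atTop hη
  have hm2sum : ∑' n, ENNReal.ofReal (m n ^ 2) ≤ ENNReal.ofReal (η * S) := by
    rw [← tsum_mul_left, ENNReal.ofReal_tsum_of_nonneg (fun n => by positivity) (hsum.mul_left η)]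
    refine ENNReal.tsum_le_tsum fun n => ENNReal.ofReal_le_ofReal ?_
    rw [hmdef, mul_pow]
    exact mul_le_mul_of_nonneg_right (by nlinarith) (by positivity)
  obtain ⟨P, hPL, hPp⟩ := exists_lipschitz_tendsto_ae hp
  set A : ℕ → E3 → ℝ := fun n x => slowApprox m (fun k => P k x) n
  have hA0 : ∀ x, A 0 x = 0 := fun x => rfl
  have hAm : ∀ n x, |A (n + 1) x - A n x| ≤ m n := fun n x =>
    abs_slowApprox_succ_sub_le (fun n => (hm n).le) _ n
  choose ℓ hℓ using exists_lipschitzWith_slowApprox m hPL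
  -- This constant serves both `A n`, for the trace, and the increment `A (n + 1) - A n`, for the
  -- gradient bound.
  set L : ℕ → ℝ := fun n => ℓ (n + 1) + ℓ n
  have hL : ∀ n, 0 ≤ L n := fun n => by positivity
  have hAL' : ∀ n x y, |A n x - A n y| ≤ ℓ n * dist x y := fun n x y => by
    simpa [Real.dist_eq] using (hℓ n).dist_le_mul x y
  have hAL : ∀ n x y, |A n x - A n y| ≤ L n * dist x y := fun n x y =>
    (hAL' n x y).trans (mul_le_mul_of_nonneg_right (by simp [L]) dist_nonneg)
  have hDL : ∀ n x y, |(A (n + 1) x - A n x) - (A (n + 1) y - A n y)| ≤ L n * dist x y :=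
    fun n x y => by
    rw [sub_sub_sub_comm, add_mul]
    exact (abs_sub _ _).trans (add_le_add (hAL' _ x y) (hAL' _ x y))
  obtain ⟨s, hs, hs1, hsL, hs2, hsvol⟩ := exists_scales hΩ hK hC hvol hm hL
  set u : ℕ → E3 → ℝ := fun n x => layerCutoff (frontier Ω) (s n) x * (A (n + 1) x - A n x)
  have huL := fun n => lipschitzWith_layerCutoff_mul (K := frontier Ω) (hs n) (hAm n) (hDL n)
    (hsL n)
  have hub := fun n => eLpNorm_layerCutoff_mul_le (hs n) hC.le (hvol _ (hs n) (hs1 n)) (hAm n)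
  have hGb := fun n => eLpNorm_partialDerivs_layerCutoff_mul_le (hs n) hC.le
    (hvol _ (hs n) (hs1 n)) (hAm n) (hDL n) (hsL n)
  have hu : ∀ n, MemLp (u n) 2 (volume.restrict Ω) := fun n =>
    ⟨(huL n).continuous.aestronglyMeasurable, (hub n).trans_lt ENNReal.ofReal_lt_top⟩
  have hG : ∀ n, MemLp (partialDerivs (u n)) 2 (volume.restrict Ω) := fun n =>
    ⟨(measurable_partialDerivs (huL n).continuous).aestronglyMeasurable,
      (hGb n).trans_lt ENNReal.ofReal_lt_top⟩
  have hq : ∀ᵐ x ∂(volume.restrict Ω), Tendsto (fun n => ∑ j ∈ Finset.range n, u j x) atTop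
      (𝓝 (layeredSeries (frontier Ω) s A x)) := by
    filter_upwards [ae_restrict_mem hΩ.measurableSet] with x hx
    exact tendsto_layeredSeries hs hs2 (infDist_frontier_pos hΩ hne hx)
  refine ⟨layeredSeries (frontier Ω) s A, ⟨?_, ?_⟩, ?_, ?_⟩
  · exact aestronglyMeasurable_of_tendsto_ae atTop
      (fun n => Finset.aestronglyMeasurable_fun_sum _ fun j _ => (hu j).1) hq
  · have h := eLpNorm_sub_partial_sum_le (fun n => (hu n).1)
      (fun n => mul_nonneg hc (mul_nonneg (hm n).le (Real.sqrt_nonneg _))) hub hq 0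
      (sum_Ico_le_of_le_half (fun n => mul_nonneg hc (mul_nonneg (hm n).le (Real.sqrt_nonneg _)))
        (fun n => ?_) 0)
    · simp only [Finset.range_zero, Finset.sum_empty, sub_zero] at h
      exact h.trans_lt ENNReal.ofReal_lt_top
    · have hr2 : √(s (n + 1)) ≤ √(s n) / 4 := by
        rw [Real.sqrt_le_left (by positivity), div_pow, Real.sq_sqrt (hs n).le]
        linarith [hs2 n]
      have h1 := mul_le_mul (hm1 n) hr2 (Real.sqrt_nonneg _) (hm n).le
      have h2 := mul_nonneg (hm n).le (Real.sqrt_nonneg (s n))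
      have h3 := mul_le_mul_of_nonneg_left h1 hc
      have h4 := mul_nonneg hc h2
      nlinarith
  · refine hasBoundaryTrace_layeredSeries hΩ hne hs hs2 hA0 (fun n => (hℓ n).continuous) hAm hmle
      hm0 hAL hL hsL hsvol hσ ?_
    filter_upwards [hPp] with y hy
    exact tendsto_slowApprox (fun n => (hm n).le) hdiv hy
  · refine (lintegral_sobolevKSq_le hc (fun n => (hm n).le) hm1 hm2 hs hs1 hs2 hu hG
      (fun n => (huL n).hasWeakGradient Ω) hub hGb hq).trans ?_
    grw [hm2sum]
    rw [← ENNReal.ofReal_mul (by positivity)]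
    exact ENNReal.ofReal_le_ofReal hηε

/-! ### The fluid domain -/

/-- For `s ≤ r` the difference of cubes is `6 r² s + 2 s³`. For `r ≤ s` the inner ball is empty and
`(r + s)³ ≤ 8 s³`. Both are at most `(6 r² + 8) s` because `s ≤ 1`. -/
lemma volume_shell_le (c : E3) {r s : ℝ} (hr : 0 ≤ r) (hs : 0 < s) (hs1 : s ≤ 1) :
    volume {x : E3 | |dist x c - r| ≤ s} ≤
      ENNReal.ofReal (Real.pi * 4 / 3 * (6 * r ^ 2 + 8) * s) := by
  have hpi := Real.pi_pos
  have hsub : {x : E3 | |dist x c - r| ≤ s} ⊆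
      Metric.closedBall c (r + s) \ Metric.ball c (r - s) := fun x hx => by
    obtain ⟨h1, h2⟩ := abs_le.1 (mem_ofPred.1 hx)
    exact ⟨Metric.mem_closedBall.2 (by linarith), fun h => by
      have := Metric.mem_ball.1 h
      linarith⟩
  refine (measure_mono hsub).trans ?_
  rw [measure_sdiff (Metric.ball_subset_closedBall.trans
    (Metric.closedBall_subset_closedBall (by linarith))) measurableSet_ball.nullMeasurableSet
    measure_ball_lt_top.ne, EuclideanSpace.volume_closedBall_fin_three,
    EuclideanSpace.volume_ball_fin_three, tsub_le_iff_right]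
  rcases le_total r s with h | h
  · refine le_add_right ?_
    rw [← ENNReal.ofReal_pow (by positivity), ← ENNReal.ofReal_mul (by positivity)]
    refine ENNReal.ofReal_le_ofReal ?_
    rw [mul_comm, mul_assoc]
    refine mul_le_mul_of_nonneg_left ?_ (by positivity)
    have h1 : (r + s) ^ 3 ≤ (2 * s) ^ 3 := pow_le_pow_left₀ (by positivity) (by linarith) 3
    have h2 : s ^ 3 ≤ s := by
      simpa using pow_le_pow_of_le_one hs.le hs1 (show 1 ≤ 3 by norm_num)
    nlinarith [mul_nonneg (sq_nonneg r) hs.le]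
  · have h0 : 0 ≤ r - s := by linarith
    rw [← ENNReal.ofReal_pow (by positivity), ← ENNReal.ofReal_mul (by positivity),
      ← ENNReal.ofReal_pow h0, ← ENNReal.ofReal_mul (by positivity),
      ← ENNReal.ofReal_add (by positivity) (by positivity)]
    refine ENNReal.ofReal_le_ofReal ?_
    have h2 : s ^ 3 ≤ s := by
      simpa using pow_le_pow_of_le_one hs.le hs1 (show 1 ≤ 3 by norm_num)
    have h3 : (r + s) ^ 3 ≤ (6 * r ^ 2 + 8) * s + (r - s) ^ 3 := by nlinarith
    have := mul_le_mul_of_nonneg_left h3 (by positivity : 0 ≤ Real.pi * 4 / 3)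
    linarith

/-- A compact set covered by finitely many spheres has neighbourhoods of volume `O(s)`. -/
lemma exists_volume_infDist_le {K : Set E3} (hK : IsCompact K) (hne : K.Nonempty)
    (F : Finset (E3 × ℝ)) (hF : ∀ c ∈ F, 0 ≤ c.2) (hKF : ∀ x ∈ K, ∃ c ∈ F, dist x c.1 = c.2) :
    ∃ C : ℝ, 0 < C ∧ ∀ s : ℝ, 0 < s → s ≤ 1 →
      volume {x | Metric.infDist x K ≤ s} ≤ ENNReal.ofReal (C * s) := by
  have hpi := Real.pi_pos
  refine ⟨∑ c ∈ F, Real.pi * 4 / 3 * (6 * c.2 ^ 2 + 8), ?_, fun s hs hs1 => ?_⟩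
  · obtain ⟨x, hx⟩ := hne
    obtain ⟨c, hc, -⟩ := hKF x hx
    exact Finset.sum_pos (fun c _ => by positivity) ⟨c, hc⟩
  · have hsub : {x | Metric.infDist x K ≤ s} ⊆ ⋃ c ∈ F, {x : E3 | |dist x c.1 - c.2| ≤ s} := by
      intro x hx
      obtain ⟨y, hy, hxy⟩ := hK.exists_infDist_eq_dist hne x
      obtain ⟨c, hc, hyc⟩ := hKF y hy
      refine mem_iUnion₂.2 ⟨c, hc, ?_⟩
      have h := abs_dist_sub_le x y c.1
      rw [hyc] at h
      exact h.trans (hxy ▸ hx)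
    refine (measure_mono hsub).trans ((measure_biUnion_finset_le _ _).trans ?_)
    rw [Finset.sum_mul, ENNReal.ofReal_sum_of_nonneg fun c _ => by positivity]
    exact Finset.sum_le_sum fun c hc => volume_shell_le c.1 (hF c hc) hs hs1

lemma finite_inclusionIndex {a d R : ℝ} (hd : 0 < d) : (inclusionIndex a d R).Finite := by
  set M : ℤ := ⌈(R + a) / d⌉
  refine (Set.finite_Icc (fun _ : Fin 3 => -M) (fun _ => M)).subset fun l hl => ?_
  have key : ∀ i, |(l i : ℝ)| ≤ M := fun i => by
    have h1 : |d * (l i : ℝ)| ≤ ‖inclusionCenter d l‖ := by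
      simpa [inclusionCenter] using PiLp.norm_apply_le (inclusionCenter d l) i
    have h2 : ‖inclusionCenter d l‖ + d / 2 - a < R := hl
    rw [abs_mul, abs_of_pos hd] at h1
    refine le_trans ?_ (Int.le_ceil _)
    rw [le_div_iff₀ hd]
    linarith
  have key' : ∀ i, -M ≤ l i ∧ l i ≤ M := fun i => by
    have := abs_le.1 (key i)
    exact_mod_cast this
  exact ⟨fun i => (key' i).1, fun i => (key' i).2⟩

lemma isClosed_biUnion_inclusion {a d R : ℝ} (hd : 0 < d) :
    IsClosed (⋃ l ∈ inclusionIndex a d R, Metric.closedBall (inclusionCenter d l) a) :=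
  (finite_inclusionIndex hd).isClosed_biUnion fun _ _ => Metric.isClosed_closedBall

lemma isOpen_fluidDomain {a d R : ℝ} (hd : 0 < d) : IsOpen (fluidDomain a d R) :=
  Metric.isOpen_ball.sdiff (isClosed_biUnion_inclusion hd)

lemma isCompact_frontier_fluidDomain (a d R : ℝ) : IsCompact (frontier (fluidDomain a d R)) :=
  Metric.isCompact_of_isClosed_isBounded isClosed_frontier
    ((Metric.isBounded_ball.subset sdiff_subset).closure.subset frontier_subset_closure)

/-- The boundary of the fluid domain lies in the union of the boundary spheres. -/
lemma frontier_fluidDomain_subset {a d R : ℝ} (hd : 0 < d) {x : E3}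
    (hx : x ∈ frontier (fluidDomain a d R)) :
    dist x 0 = R ∨ ∃ l ∈ inclusionIndex a d R, dist x (inclusionCenter d l) = a := by
  rw [(isOpen_fluidDomain hd).frontier_eq] at hx
  obtain ⟨hxc, hxn⟩ := hx
  by_contra! h
  obtain ⟨h1, h2⟩ := h
  have hball : x ∈ Metric.ball (0 : E3) R := by
    have : x ∈ Metric.closedBall (0 : E3) R :=
      Metric.closure_ball_subset_closedBall (closure_mono sdiff_subset hxc)
    exact lt_of_le_of_ne this h1
  refine hxn ⟨hball, fun hmem => ?_⟩
  obtain ⟨l, hl, hxl⟩ := mem_iUnion₂.1 hmem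
  -- The interior of a removed ball is an open set that misses the domain, so it contains no point
  -- of the closure.
  have hlt : x ∈ Metric.ball (inclusionCenter d l) a := lt_of_le_of_ne hxl (h2 l hl)
  obtain ⟨z, hz1, hz2⟩ := mem_closure_iff.1 hxc _ Metric.isOpen_ball hlt
  exact hz2.2 (mem_iUnion₂.2 ⟨l, hl, Metric.ball_subset_closedBall hz1⟩)

instance isFiniteMeasure_sphereArea (c : E3) (r : ℝ) : IsFiniteMeasure (sphereArea c r) := by
  unfold sphereArea
  exact Measure.smul_finite _ ENNReal.ofReal_ne_top

lemma isFiniteMeasure_fluidBoundaryArea {a d R : ℝ} (hd : 0 < d) :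
    IsFiniteMeasure (fluidBoundaryArea a d R) := by
  have := (finite_inclusionIndex (a := a) (R := R) hd).fintype
  unfold fluidBoundaryArea
  rw [Measure.sum_fintype]
  infer_instance

lemma ae_fluidBoundaryArea_mem_frontier (a d R : ℝ) :
    ∀ᵐ y ∂(fluidBoundaryArea a d R), y ∈ frontier (fluidDomain a d R) :=
  ae_restrict_mem isClosed_frontier.measurableSet

lemma extensionConst_pos {a d R : ℝ} (ha : 0 < a) (had : a < d) (hdR : d < R) :
    0 < extensionConst a d R := by
  have hd : 0 < d := ha.trans had
  have hR : 0 < R := hd.trans hdR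
  have : 0 < R - d / 2 := by linarith
  unfold extensionConst
  positivity

lemma exists_volume_fluidDomain_layer_le {a d R : ℝ} (ha : 0 < a) (had : a < d) (hdR : d < R)
    (hne : (frontier (fluidDomain a d R)).Nonempty) :
    ∃ C : ℝ, 0 < C ∧ ∀ s : ℝ, 0 < s → s ≤ 1 →
      volume (fluidDomain a d R ∩ {x | Metric.infDist x (frontier (fluidDomain a d R)) ≤ s}) ≤
        ENNReal.ofReal (C * s) := by
  classical
  have hd : 0 < d := ha.trans had
  suffices h : ∃ C : ℝ, 0 < C ∧ ∀ s : ℝ, 0 < s → s ≤ 1 →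
      volume {x | Metric.infDist x (frontier (fluidDomain a d R)) ≤ s} ≤ ENNReal.ofReal (C * s) by
    obtain ⟨C, hC, h⟩ := h
    exact ⟨C, hC, fun s hs hs1 => (measure_mono inter_subset_right).trans (h s hs hs1)⟩
  refine exists_volume_infDist_le (isCompact_frontier_fluidDomain a d R) hne
    (insert (0, R) ((finite_inclusionIndex (a := a) (R := R) hd).toFinset.image
      fun l => (inclusionCenter d l, a))) (fun c hc => ?_) (fun x hx => ?_)
  · rw [Finset.mem_insert, Finset.mem_image] at hc
    rcases hc with rfl | ⟨l, -, rfl⟩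
    · exact (hd.trans hdR).le
    · exact ha.le
  · rcases frontier_fluidDomain_subset hd hx with h | ⟨l, hl, h⟩
    · exact ⟨_, Finset.mem_insert_self _ _, h⟩
    · exact ⟨(inclusionCenter d l, a), Finset.mem_insert_of_mem (Finset.mem_image.2
        ⟨l, (finite_inclusionIndex hd).mem_toFinset.2 hl, rfl⟩), h⟩

/-! ### From the integral of the `K`-functional to the norm, and the conclusion -/

lemma hHalfNorm_zero (Ω : Set E3) : hHalfNorm Ω 0 = 0 := by
  have h : ∀ t, sobolevKSq Ω t 0 = 0 := fun t => by
    refine le_antisymm ((sobolevKSq_le (v := 0) (G := 0) MemLp.zero MemLp.zero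
      (fun φ _ _ _ i => by simp) t).trans ?_) zero_le
    simp [eLpNorm_zero']
  simp [hHalfNorm, h]

lemma hHalfNorm_le_of_lintegral_le {Ω : Set E3} {q : E3 → ℝ} {b : ℝ} (hb : 0 ≤ b)
    (h : ∫⁻ t in Ioi (0 : ℝ), ENNReal.ofReal ((t ^ 2)⁻¹) * sobolevKSq Ω t q ≤
      ENNReal.ofReal (b ^ 2)) : hHalfNorm Ω q ≤ ENNReal.ofReal b := by
  have hpi : 2 / Real.pi ≤ 1 := by
    rw [div_le_one Real.pi_pos]
    exact Real.two_le_pi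
  calc hHalfNorm Ω q ≤ (1 * ENNReal.ofReal (b ^ 2)) ^ (1 / 2 : ℝ) := by
        refine ENNReal.rpow_le_rpow (mul_le_mul' ?_ h) (by norm_num)
        exact ENNReal.ofReal_le_one.2 hpi
    _ = ENNReal.ofReal b := by
        rw [one_mul, ENNReal.ofReal_rpow_of_nonneg (by positivity) (by norm_num),
          ← Real.sqrt_eq_rpow, Real.sqrt_sq hb]

theorem theorem2p9 (a d R : ℝ) (ha : 0 < a) (had : a < d) (hdR : d < R)
    (p : E3 → ℝ) (hp : MemLp p 2 (fluidBoundaryArea a d R)) :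
    ∃ q : E3 → ℝ,
      MemHHalf (fluidDomain a d R) q ∧
      HasBoundaryTrace (fluidDomain a d R) (fluidBoundaryArea a d R) q p ∧
      hHalfNorm (fluidDomain a d R) q ≤
        ENNReal.ofReal (extensionConst a d R) * eLpNorm p 2 (fluidBoundaryArea a d R) := by
  have hd : 0 < d := ha.trans had
  have := isFiniteMeasure_fluidBoundaryArea (a := a) (R := R) hd
  have hσ := ae_fluidBoundaryArea_mem_frontier a d R
  -- Vanishing data leave no positive room for the norm of the extension and are extended by zero.
  rcases eq_or_ne (eLpNorm p 2 (fluidBoundaryArea a d R)) 0 with h0 | h0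
  · refine ⟨0, ⟨MemLp.zero, by simp [hHalfNorm_zero]⟩, ?_, by simp [hHalfNorm_zero]⟩
    filter_upwards [(eLpNorm_eq_zero_iff hp.1 two_ne_zero).1 h0] with y hy
    simp [hy]
  -- The layers need a nonempty boundary, as `Metric.infDist` to the empty set is `0` by default.
  have hne : (frontier (fluidDomain a d R)).Nonempty := by
    by_contra hemp
    refine h0 ((eLpNorm_eq_zero_iff hp.1 two_ne_zero).2 ?_)
    filter_upwards [hσ] with y hy using absurd ⟨y, hy⟩ hemp
  obtain ⟨C, hC, hvol⟩ := exists_volume_fluidDomain_layer_le ha had hdR hne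
  have hN : 0 < (eLpNorm p 2 (fluidBoundaryArea a d R)).toReal :=
    ENNReal.toReal_pos h0 hp.eLpNorm_ne_top
  have hb := mul_pos (extensionConst_pos ha had hdR) hN
  -- The arbitrary bound `ε` is taken to be `(β ‖p‖)²`.
  obtain ⟨q, hq, htr, hint⟩ := exists_extension_lintegral_sobolevKSq_le (isOpen_fluidDomain hd)
    (isCompact_frontier_fluidDomain a d R) hne hC hvol hσ hp (pow_pos hb 2)
  have hnorm := hHalfNorm_le_of_lintegral_le hb.le hint
  refine ⟨q, ⟨hq, hnorm.trans_lt ENNReal.ofReal_lt_top⟩, htr, hnorm.trans_eq ?_⟩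
  rw [ENNReal.ofReal_mul (extensionConst_pos ha had hdR).le,
    ENNReal.ofReal_toReal hp.eLpNorm_ne_top]
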